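/- Let $E=\mathbb{R}\times\{-1,+1\}$ with the product topology, let $C_0(E)$ be the space of continuous functions $E\to\mathbb{R}$ vanishing at infinity, let $a>0$, and let $\lambda:E\to[0,\infty)$ be continuous. Assume that there are constants $y_0\ge 0$ and $\lambda_{\min}>0$ such that $\lambda(y,j)\ge\lambda_{\min}$ whenever $jy\ge y_0$ (no upper bound on $\lambda$ is assumed). For $(y,j)\in E$ and $t\ge 0$ put $F(t;y,j)=\exp\bigl(-\int_0^t\lambda(y+ajs,j)\,ds\bigr)$. The zig-zag process $(Y(t),J(t))_{t\ge 0}$ started from $(y,j)$ is constructed under $\mathbb{P}_{y,j}$ as follows: $T_0=0$, $(Y(0),J(0))=(y,j)$ and, for $i=1,2,\dots$, $T_i=T_{i-1}+Z_i$, where $\mathbb{P}_{y,j}(Z_i>t\mid Z_1,\dots,Z_{i-1})=F(t;Y(T_{i-1}),J(T_{i-1}))$ for $t\ge0$; moreover $Y(t)=Y(T_{i-1})+aJ(T_{i-1})(t-T_{i-1})$ for $T_{i-1}<t\le T_i$, $J(t)=J(T_{i-1})$ for $T_{i-1}<t<T_i$, and $J(T_i)=-J(T_{i-1})$. Let $P(t)\varphi(y,j)=\mathbb{E}_{y,j}[\varphi(Y(t),J(t))]$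 be the associated transition semigroup. Then $T_n\to\infty$ almost surely under every $\mathbb{P}_{y,j}$, so that the process is defined for all times and $P(t)$ is well defined, and the semigroup is Feller: for every $\varphi\in C_0(E)$ and every $t\ge 0$, $P(t)\varphi\in C_0(E)$. -/

import Mathlib

open MeasureTheory ProbabilityTheory Filter Topology Set
open scoped ZeroAtInfty

/-- The state space `E = ℝ × {-1, +1}` with the product topology; the group `ℤˣ = {1, -1}` plays
the role of the two-point set of directions. -/
abbrev ZigZagSpace : Type := ℝ × ℤˣ

instance zigZagDirection_discreteMeasurable : DiscreteMeasurableSpace ℤˣ where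
  forall_measurableSet s :=
    ⟨Units.val '' s, MeasurableSet.of_discrete, Set.preimage_image_eq s Units.val_injective⟩

/-- The data of a zig-zag process: the speed `a > 0`, the continuous switching rate
`λ : E → [0, ∞)`, and the lower bound on the rate of good switches in the tails. -/
structure ZigZagModel where
  /-- the speed -/
  a : ℝ
  a_pos : 0 < a
  /-- the switching rate -/
  rate : ZigZagSpace → ℝ
  rate_continuous : Continuous rate
  rate_nonneg : ∀ x, 0 ≤ rate x
  rate_tail : ∃ y₀ : ℝ, 0 ≤ y₀ ∧ ∃ lmin : ℝ, 0 < lmin ∧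
    ∀ (y : ℝ) (j : ℤˣ), y₀ ≤ ((j : ℤ) : ℝ) * y → lmin ≤ rate (y, j)

namespace ZigZagModel

variable (M : ZigZagModel)

/-- The position `y + a j s` reached from `(y, j)` after moving for time `s` without switching,
together with the unchanged direction `j`. -/
def flow (x : ZigZagSpace) (s : ℝ) : ZigZagSpace :=
  (x.1 + M.a * ((x.2 : ℤ) : ℝ) * s, x.2)

/-- The survival function `F(t; y, j) = exp (- ∫₀ᵗ λ(y + a j s, j) ds)`. -/
noncomputable def survival (x : ZigZagSpace) (t : ℝ) : ℝ :=
  Real.exp (-∫ s in (0 : ℝ)..t, M.rate (M.flow x s))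

/-- The law on `(0, ∞)` with distribution function `1 - F(·; y, j)`, given by its density
`-F'(t; y, j) = λ(y + a j t, j) F(t; y, j)`; see `holdingLaw_Ioi`. -/
noncomputable def holdingLaw (x : ZigZagSpace) : Measure ℝ :=
  (volume.restrict (Ioi 0)).withDensity
    fun t => ENNReal.ofReal (M.rate (M.flow x t) * M.survival x t)

theorem continuous_flow : Continuous fun p : ZigZagSpace × ℝ => M.flow p.1 p.2 := by
  have h : Continuous fun j : ℤˣ => ((j : ℤ) : ℝ) := continuous_of_discreteTopology
  have h' : Continuous fun p : ZigZagSpace × ℝ => ((p.1.2 : ℤ) : ℝ) :=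
    h.comp (continuous_snd.comp continuous_fst)
  unfold flow
  fun_prop

theorem continuous_rate_flow :
    Continuous fun p : ZigZagSpace × ℝ => M.rate (M.flow p.1 p.2) :=
  M.rate_continuous.comp M.continuous_flow

theorem continuous_survival : Continuous fun p : ZigZagSpace × ℝ => M.survival p.1 p.2 := by
  unfold survival
  refine Real.continuous_exp.comp (Continuous.neg ?_)
  exact intervalIntegral.continuous_parametric_primitive_of_continuous
    (f := fun x s => M.rate (M.flow x s)) M.continuous_rate_flow

theorem continuous_rate_flow_right (x : ZigZagSpace) :
    Continuous fun s => M.rate (M.flow x s) :=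
  M.continuous_rate_flow.comp (by fun_prop : Continuous fun s : ℝ => (x, s))

theorem hasDerivAt_neg_survival (x : ZigZagSpace) (t : ℝ) :
    HasDerivAt (fun t => -M.survival x t) (M.rate (M.flow x t) * M.survival x t) t := by
  have hc := M.continuous_rate_flow_right x
  have h := intervalIntegral.integral_hasDerivAt_right (hc.intervalIntegrable 0 t)
    (hc.stronglyMeasurableAtFilter _ _) hc.continuousAt
  refine h.neg.exp.neg.congr_deriv ?_
  change -(Real.exp (-∫ s in (0 : ℝ)..t, M.rate (M.flow x s)) * -M.rate (M.flow x t)) =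
    M.rate (M.flow x t) * Real.exp (-∫ s in (0 : ℝ)..t, M.rate (M.flow x s))
  ring

theorem tendsto_survival (x : ZigZagSpace) :
    Tendsto (M.survival x) atTop (𝓝 0) := by
  obtain ⟨y₀, -, l, hl, h⟩ := M.rate_tail
  have hc := M.continuous_rate_flow_right x
  obtain ⟨y, j⟩ := x
  have ha := M.a_pos
  have hj : ((j : ℤ) : ℝ) * ((j : ℤ) : ℝ) = 1 := by
    rcases Int.units_eq_one_or j with rfl | rfl <;> simp
  set c : ℝ := ((j : ℤ) : ℝ) with hcdef
  set t₀ : ℝ := (|y₀| + |c * y|) / M.a with ht₀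
  have key : ∀ s, t₀ ≤ s → l ≤ M.rate (M.flow (y, j) s) := by
    intro s hs
    apply h
    have h1 : |y₀| + |c * y| ≤ s * M.a := (div_le_iff₀ ha).1 hs
    have h2 := neg_abs_le (c * y)
    have h3 := le_abs_self y₀
    have h4 : c * (y + M.a * c * s) = c * y + s * M.a := by linear_combination (M.a * s) * hj
    rw [← hcdef, h4]
    linarith
  unfold survival
  refine Real.tendsto_exp_neg_atTop_nhds_zero.comp ?_
  have hlin : Tendsto (fun t => (∫ s in (0 : ℝ)..t₀, M.rate (M.flow (y, j) s)) + l * (t - t₀))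
      atTop atTop :=
    tendsto_atTop_add_const_left _ _
      ((tendsto_atTop_add_const_right _ (-t₀) tendsto_id).const_mul_atTop hl)
  refine tendsto_atTop_mono' _ ?_ hlin
  filter_upwards [eventually_ge_atTop t₀] with t ht
  rw [← intervalIntegral.integral_add_adjacent_intervals (hc.intervalIntegrable 0 t₀)
    (hc.intervalIntegrable t₀ t)]
  gcongr
  have := intervalIntegral.integral_mono_on (μ := volume) ht (intervalIntegrable_const (c := l))
    (hc.intervalIntegrable t₀ t) (fun s hs => key s hs.1)
  simpa [mul_comm] using this

/-- A holding time `Z` with law `holdingLaw x` satisfies `ℙ(Z > t) = F(t; x)`. -/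
theorem holdingLaw_Ioi (x : ZigZagSpace) {t : ℝ} (ht : 0 ≤ t) :
    M.holdingLaw x (Ioi t) = ENNReal.ofReal (M.survival x t) := by
  have hlim : Tendsto (fun t => -M.survival x t) atTop (𝓝 (-0)) := (M.tendsto_survival x).neg
  have hnn : ∀ s, 0 ≤ M.rate (M.flow x s) * M.survival x s := fun s =>
    mul_nonneg (M.rate_nonneg _) (Real.exp_pos _).le
  have hint := integrableOn_Ioi_deriv_of_nonneg' (a := t)
    (fun s _ => M.hasDerivAt_neg_survival x s) (fun s _ => hnn s) hlim
  have hval := integral_Ioi_of_hasDerivAt_of_nonneg' (a := t)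
    (fun s _ => M.hasDerivAt_neg_survival x s) (fun s _ => hnn s) hlim
  rw [holdingLaw, withDensity_apply _ measurableSet_Ioi,
    Measure.restrict_restrict measurableSet_Ioi,
    inter_eq_left.2 (Ioi_subset_Ioi ht),
    ← ofReal_integral_eq_lintegral_ofReal hint (ae_of_all _ hnn), hval]
  simp

instance (x : ZigZagSpace) : IsProbabilityMeasure (M.holdingLaw x) := by
  constructor
  have h0 := M.holdingLaw_Ioi x le_rfl
  have h1 : M.holdingLaw x (Iic 0) = 0 := by
    rw [holdingLaw, withDensity_apply _ measurableSet_Iic,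
      Measure.restrict_restrict measurableSet_Iic,
      (Iic_disjoint_Ioi (le_refl (0 : ℝ))).inter_eq, Measure.restrict_empty, lintegral_zero_measure]
  rw [← Iic_union_Ioi (a := (0 : ℝ)),
    measure_union (Iic_disjoint_Ioi le_rfl) measurableSet_Ioi, h0, h1]
  simp [survival]

/-- The holding-time laws, as a Markov kernel from `E` to `ℝ`. -/
noncomputable def holdingKernel : Kernel ZigZagSpace ℝ where
  toFun := M.holdingLaw
  measurable' := by
    have hm : Measurable (Function.uncurry fun (x : ZigZagSpace) (t : ℝ) =>
        ENNReal.ofReal (M.rate (M.flow x t) * M.survival x t)) :=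
      ENNReal.measurable_ofReal.comp
        (M.continuous_rate_flow.mul M.continuous_survival).measurable
    have h : M.holdingLaw = fun x => (Kernel.withDensity
        (Kernel.const ZigZagSpace (volume.restrict (Ioi (0 : ℝ))))
        fun x t => ENNReal.ofReal (M.rate (M.flow x t) * M.survival x t)) x := by
      funext x
      rw [Kernel.withDensity_apply _ hm]
      rfl
    rw [h]
    exact Kernel.measurable _

instance : IsMarkovKernel M.holdingKernel :=
  ⟨fun x => inferInstanceAs (IsProbabilityMeasure (M.holdingLaw x))⟩

/-- The effect of a holding time `z` on a pair (state just after a switch, time of that switch):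
move for time `z`, then reverse the direction; `(Y, J), T ↦ (Y + a J z, -J), T + z`. -/
def jump (p : (ZigZagSpace × ℝ) × ℝ) : ZigZagSpace × ℝ :=
  (((M.flow p.1.1 p.2).1, -p.1.1.2), p.1.2 + p.2)

theorem measurable_jump : Measurable M.jump := by
  have hf : Measurable fun p : (ZigZagSpace × ℝ) × ℝ => M.flow p.1.1 p.2 :=
    M.continuous_flow.measurable.comp
      ((measurable_fst.comp measurable_fst).prodMk measurable_snd)
  have hneg : Measurable fun j : ℤˣ => -j := Measurable.of_discrete
  exact ((measurable_fst.comp hf).prodMk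
    (hneg.comp (measurable_snd.comp (measurable_fst.comp measurable_fst)))).prodMk
    ((measurable_snd.comp measurable_fst).add measurable_snd)

/-- The transition kernel of the chain `((Y(Tₙ), J(Tₙ)), Tₙ)`: draw `Z` from the holding-time law
of `(Y(Tₙ), J(Tₙ))`, then apply `jump`. -/
noncomputable def jumpKernel : Kernel (ZigZagSpace × ℝ) (ZigZagSpace × ℝ) :=
  (Kernel.id ×ₖ M.holdingKernel.comap Prod.fst measurable_fst).map M.jump

instance : IsMarkovKernel M.jumpKernel :=
  Kernel.IsMarkovKernel.map _ M.measurable_jump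

/-- The law `ℙ_{y,j}` of the sequence `((Y(Tₙ), J(Tₙ)), Tₙ)`, `n = 0, 1, 2, …`, started from
`((y, j), 0)`: the Markov chain with transition kernel `jumpKernel`. -/
noncomputable def law (x : ZigZagSpace) : Measure (ℕ → ZigZagSpace × ℝ) :=
  Kernel.trajMeasure (X := fun _ => ZigZagSpace × ℝ) (Measure.dirac (x, 0))
    (fun n => M.jumpKernel.comap
      (fun h : (i : Finset.Iic n) → ZigZagSpace × ℝ => h ⟨n, Finset.mem_Iic.2 le_rfl⟩)
      (measurable_pi_apply _))

/-- The `n`-th switching time `Tₙ`. -/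
def switchTime (ω : ℕ → ZigZagSpace × ℝ) (n : ℕ) : ℝ := (ω n).2

/-- `N(t) = sup {k : T_k ≤ t}`, the number of switches up to time `t`. The supremum of an
unbounded set of naturals is `0` by convention. -/
noncomputable def switchCount (t : ℝ) (ω : ℕ → ZigZagSpace × ℝ) : ℕ :=
  sSup {k : ℕ | switchTime ω k ≤ t}

/-- The zig-zag process `(Y(t), J(t))`: with `n = N(t)`, it moves from `(Y(Tₙ), J(Tₙ))` for time
`t - Tₙ` without switching. -/
noncomputable def process (t : ℝ) (ω : ℕ → ZigZagSpace × ℝ) : ZigZagSpace :=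
  M.flow (ω (switchCount t ω)).1 (t - switchTime ω (switchCount t ω))

/-- The transition semigroup `P(t) φ (y, j) = 𝔼_{y,j} [φ(Y(t), J(t))]`. -/
noncomputable def semigroup (t : ℝ) (φ : ZigZagSpace → ℝ) (x : ZigZagSpace) : ℝ :=
  ∫ ω, φ (M.process t ω) ∂(M.law x)

end ZigZagModel

/-!
The states and times at the successive switches form a Markov chain. The process moves at speed
`a`, so up to time `t` it stays in a compact set, on which the rate is bounded by some `Λ`; a Picard
iteration of the renewal operator then gives `ℙ (Tₙ ≤ t) ≤ (Λ t) ^ n / n!`, and non-explosion is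
the Borel–Cantelli lemma. Conditioning on the number of switches up to time `t` writes `P(t) φ` as
a sum of iterates of the renewal operator. Each term is continuous, and because `Λ` can be chosen
uniformly for starting points in a compact set, the same bound makes the series locally uniformly
convergent, even when the rate is unbounded. Finally `|Y(t) - Y(0)| ≤ a t`, so `P(t)` preserves
vanishing at infinity.
-/

section General

variable {α β γ Ω R F : Type*} [MeasurableSpace α] [MeasurableSpace β] [MeasurableSpace γ]
  [MeasurableSpace Ω] [NormedAddCommGroup F] [NormedSpace ℝ F]

theorem map_prodMap_id_compProd_comap {f : α → β} (hf : Measurable f) (μ : Measure α) [SFinite μ]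
    (κ : Kernel β γ) [IsSFiniteKernel κ] :
    (μ ⊗ₘ κ.comap f hf).map (Prod.map f id) = μ.map f ⊗ₘ κ := by
  have hfid : Measurable (Prod.map f (id : γ → γ)) := hf.prodMap measurable_id
  ext s hs
  rw [Measure.map_apply hfid hs, Measure.compProd_apply (hfid hs), Measure.compProd_apply hs,
    lintegral_map (Kernel.measurable_kernel_prodMk_left hs) hf]
  rfl

theorem ae_tendsto_atTop_of_tsum_measure_le_ne_top [LinearOrder R] {μ : Measure Ω}
    {T : ℕ → Ω → R} {u : ℕ → R} (hu : Tendsto u atTop atTop)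
    (h : ∀ k, ∑' n, μ {ω | T n ω ≤ u k} ≠ ⊤) :
    ∀ᵐ ω ∂μ, Tendsto (fun n => T n ω) atTop atTop := by
  filter_upwards [ae_all_iff.2 fun k => ae_eventually_notMem (h k)] with ω hω
  refine tendsto_atTop.2 fun b => ?_
  obtain ⟨k, hk⟩ := (hu.eventually_ge_atTop b).exists
  filter_upwards [hω k] with n hn
  exact hk.trans (not_le.1 hn).le

theorem tendsto_integral_comap_cobounded {E V : Type*} [PseudoMetricSpace V] {μ : E → Measure Ω}
    [∀ x, IsProbabilityMeasure (μ x)] {X : E → Ω → E} {π : E → V} {φ : E → F} {r : ℝ}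
    (hX : ∀ x, ∀ᵐ ω ∂μ x, dist (π x) (π (X x ω)) ≤ r)
    (hφ : Tendsto φ (comap π (Bornology.cobounded V)) (𝓝 0)) :
    Tendsto (fun x => ∫ ω, φ (X x ω) ∂μ x) (comap π (Bornology.cobounded V)) (𝓝 0) := by
  refine NormedAddGroup.tendsto_nhds_zero.2 fun ε hε => ?_
  obtain ⟨S, hS, hSφ⟩ :=
    mem_comap.1 (NormedAddGroup.tendsto_nhds_zero.1 hφ (ε / 2) (half_pos hε))
  have hbdd : Bornology.IsBounded (Metric.cthickening r Sᶜ) :=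
    (Bornology.isBounded_compl_iff.2 hS).cthickening
  refine mem_comap.2 ⟨_, hbdd.compl, fun x hx => ?_⟩
  have hsmall : ∀ᵐ ω ∂μ x, ‖φ (X x ω)‖ ≤ ε / 2 := by
    filter_upwards [hX x] with ω hω
    have hmem : π (X x ω) ∈ S := not_not.1 fun hnot =>
      hx (Metric.mem_cthickening_of_dist_le _ _ _ _ hnot hω)
    exact (hSφ hmem).le
  calc ‖∫ ω, φ (X x ω) ∂μ x‖ ≤ ε / 2 := by
        simpa using norm_integral_le_of_norm_le_const hsmall
    _ < ε := half_lt_self hε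

theorem cocompact_prod_eq_comap_fst {V K : Type*} [TopologicalSpace V] [TopologicalSpace K]
    [CompactSpace K] : cocompact (V × K) = comap Prod.fst (cocompact V) := by
  rw [← coprod_cocompact, cocompact_eq_bot (X := K), coprod_bot]

theorem sSup_setOf_le_eq_iff [LinearOrder R] {f : ℕ → R} (hf : Monotone f) {t : R}
    (h0 : f 0 ≤ t) (hlt : ∃ k, t < f k) {n : ℕ} :
    sSup {k | f k ≤ t} = n ↔ f n ≤ t ∧ t < f (n + 1) := by
  obtain ⟨K, hK⟩ := hlt
  have hbdd : BddAbove {k | f k ≤ t} :=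
    ⟨K, fun k hk => (hf.reflect_lt (lt_of_le_of_lt hk hK)).le⟩
  constructor
  · rintro rfl
    exact ⟨Nat.sSup_mem ⟨0, h0⟩ hbdd,
      not_le.1 fun hle => (Nat.lt_succ_self _).not_ge (le_csSup hbdd hle)⟩
  · rintro ⟨hn, hn'⟩
    have hIic : {k | f k ≤ t} = Iic n := Set.ext fun k =>
      ⟨fun hk => Nat.lt_succ_iff.1 (hf.reflect_lt (lt_of_le_of_lt hk hn')),
        fun hk => (hf hk).trans hn⟩
    rw [hIic, csSup_Iic]

theorem integral_mul_pow_sub_div_factorial (Λ τ : ℝ) (n : ℕ) :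
    ∫ s in (0 : ℝ)..τ, Λ * ((Λ * (τ - s)) ^ n / n.factorial) =
      (Λ * τ) ^ (n + 1) / (n + 1).factorial := by
  have hn : (n.factorial : ℝ) ≠ 0 := by positivity
  have hn' : (n : ℝ) + 1 ≠ 0 := by positivity
  simp_rw [mul_pow, mul_div_right_comm (Λ ^ n), ← mul_assoc]
  rw [intervalIntegral.integral_const_mul,
    intervalIntegral.integral_comp_sub_left (fun s => s ^ n) τ, integral_pow, Nat.factorial_succ]
  push_cast
  simp only [sub_self, sub_zero, zero_pow (Nat.succ_ne_zero n)]
  field_simp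
  ring

end General

/-- The law on `ℕ → X` of the time-homogeneous Markov chain with transition kernel `κ` and initial
law `μ₀`. -/
noncomputable def chainLaw {X : Type*} [MeasurableSpace X] (κ : Kernel X X) [IsMarkovKernel κ]
    (μ₀ : Measure X) : Measure (ℕ → X) :=
  Kernel.trajMeasure (X := fun _ => X) μ₀ fun n =>
    κ.comap (fun h : Finset.Iic n → X => h ⟨n, Finset.mem_Iic.2 le_rfl⟩) (measurable_pi_apply _)

namespace chainLaw

variable {X F : Type*} [MeasurableSpace X] [NormedAddCommGroup F] [NormedSpace ℝ F]
  (κ : Kernel X X) [IsMarkovKernel κ] (μ₀ : Measure X)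

instance [IsProbabilityMeasure μ₀] : IsProbabilityMeasure (chainLaw κ μ₀) :=
  inferInstanceAs (IsProbabilityMeasure (Kernel.trajMeasure _ _))

theorem map_eval_zero : (chainLaw κ μ₀).map (fun ω => ω 0) = μ₀ := by
  let e := MeasurableEquiv.piUnique fun _ : Finset.Iic 0 => X
  have hfr : (chainLaw κ μ₀).map (Preorder.frestrictLe 0) = μ₀.map e.symm := by
    rw [chainLaw, Kernel.trajMeasure, Measure.map_comp _ _ (by fun_prop),
      Kernel.traj_map_frestrictLe, Kernel.partialTraj_self, Measure.id_comp]
  change (chainLaw κ μ₀).map (e ∘ Preorder.frestrictLe 0) = μ₀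
  rw [← Measure.map_map e.measurable (by fun_prop), hfr, MeasurableEquiv.map_map_symm]

variable [IsProbabilityMeasure μ₀]

theorem map_eval_succ (n : ℕ) :
    (chainLaw κ μ₀).map (fun ω => (ω n, ω (n + 1))) =
      (chainLaw κ μ₀).map (fun ω => ω n) ⊗ₘ κ := by
  let last : (Finset.Iic n → X) → X := fun h => h ⟨n, Finset.mem_Iic.2 le_rfl⟩
  have hlast : Measurable last := measurable_pi_apply _
  have hfr : Measurable (Preorder.frestrictLe (π := fun _ : ℕ => X) n) :=
    Preorder.measurable_frestrictLe n
  have hmarkov : (chainLaw κ μ₀).map (Preorder.frestrictLe n) ⊗ₘ κ.comap last hlast =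
      (chainLaw κ μ₀).map fun ω => (Preorder.frestrictLe n ω, ω (n + 1)) :=
    Kernel.map_frestrictLe_trajMeasure_compProd_eq_map_trajMeasure
  calc (chainLaw κ μ₀).map (fun ω => (ω n, ω (n + 1)))
      = ((chainLaw κ μ₀).map fun ω => (Preorder.frestrictLe n ω, ω (n + 1))).map
          (Prod.map last id) :=
        (Measure.map_map (hlast.prodMap measurable_id)
          (hfr.prodMk (measurable_pi_apply _))).symm
    _ = ((chainLaw κ μ₀).map (Preorder.frestrictLe n)).map last ⊗ₘ κ := by
        rw [← hmarkov, map_prodMap_id_compProd_comap]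
    _ = (chainLaw κ μ₀).map (fun ω => ω n) ⊗ₘ κ := by
        rw [Measure.map_map hlast hfr]
        rfl

theorem ae_forall_step {r : X × X → Prop} (hr : MeasurableSet {p | r p})
    (h : ∀ p, ∀ᵐ q ∂κ p, r (p, q)) :
    ∀ᵐ ω ∂chainLaw κ μ₀, ∀ n, r (ω n, ω (n + 1)) := by
  refine ae_all_iff.2 fun n => ?_
  have hpair : Measurable fun ω : ℕ → X => (ω n, ω (n + 1)) := by fun_prop
  have hmap : ∀ᵐ p ∂(chainLaw κ μ₀).map fun ω => (ω n, ω (n + 1)), r p := by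
    rw [map_eval_succ]
    exact Measure.ae_compProd_of_ae_ae hr (ae_of_all _ h)
  exact (ae_map_iff hpair.aemeasurable hr).1 hmap

theorem setIntegral_step (n : ℕ) {A B : Set X} (hA : MeasurableSet A) (hB : MeasurableSet B)
    {f : X × X → F} (hf : StronglyMeasurable f)
    (hfi : IntegrableOn (fun ω => f (ω n, ω (n + 1))) {ω | ω n ∈ A ∧ ω (n + 1) ∈ B}
      (chainLaw κ μ₀)) :
    ∫ ω in {ω | ω n ∈ A ∧ ω (n + 1) ∈ B}, f (ω n, ω (n + 1)) ∂chainLaw κ μ₀ =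
      ∫ ω in {ω | ω n ∈ A}, ∫ y in B, f (ω n, y) ∂κ (ω n) ∂chainLaw κ μ₀ := by
  have hn : Measurable fun ω : ℕ → X => ω n := measurable_pi_apply n
  have hpair : Measurable fun ω : ℕ → X => (ω n, ω (n + 1)) := by fun_prop
  have hfi' : IntegrableOn f (A ×ˢ B) ((chainLaw κ μ₀).map (fun ω => ω n) ⊗ₘ κ) := by
    rw [← map_eval_succ, IntegrableOn, Measure.restrict_map hpair (hA.prod hB),
      integrable_map_measure hf.aestronglyMeasurable hpair.aemeasurable]
    exact hfi
  have hinner : StronglyMeasurable fun x => ∫ y in B, f (x, y) ∂κ x := by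
    simp_rw [← Kernel.restrict_apply κ hB]
    exact hf.integral_kernel_prod_right'
  calc ∫ ω in {ω | ω n ∈ A ∧ ω (n + 1) ∈ B}, f (ω n, ω (n + 1)) ∂chainLaw κ μ₀
      = ∫ p in A ×ˢ B, f p ∂(chainLaw κ μ₀).map fun ω => (ω n, ω (n + 1)) :=
        (setIntegral_map (hA.prod hB) hf.aestronglyMeasurable hpair.aemeasurable).symm
    _ = ∫ x in A, ∫ y in B, f (x, y) ∂κ x ∂(chainLaw κ μ₀).map fun ω => ω n := by
        rw [map_eval_succ, Measure.setIntegral_compProd hA hB hfi']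
    _ = _ := setIntegral_map hA hinner.aestronglyMeasurable hn.aemeasurable

end chainLaw

namespace ZigZagModel

open scoped BoundedContinuousFunction

variable (M : ZigZagModel)

theorem law_eq_chainLaw (x : ZigZagSpace) :
    M.law x = chainLaw M.jumpKernel (Measure.dirac (x, 0)) :=
  rfl

instance (x : ZigZagSpace) : IsProbabilityMeasure (M.law x) :=
  inferInstanceAs (IsProbabilityMeasure (chainLaw _ _))

theorem ae_law_zero (x : ZigZagSpace) : ∀ᵐ ω ∂M.law x, ω 0 = (x, 0) := by
  have h : ∀ᵐ p ∂(M.law x).map (fun ω => ω 0), p = (x, 0) := by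
    rw [law_eq_chainLaw, chainLaw.map_eval_zero]
    exact (ae_dirac_iff (measurableSet_singleton _)).2 rfl
  exact ae_of_ae_map (measurable_pi_apply 0).aemeasurable h

theorem measurableSet_switchTime_le (t : ℝ) (n : ℕ) : MeasurableSet {ω | switchTime ω n ≤ t} :=
  measurableSet_le (measurable_snd.comp (measurable_pi_apply n)) measurable_const

theorem jumpKernel_apply (p : ZigZagSpace × ℝ) :
    M.jumpKernel p = (M.holdingLaw p.1).map fun z => M.jump (p, z) := by
  have h : Measurable fun z : ℝ => (p, z) := measurable_prodMk_left
  rw [jumpKernel, Kernel.map_apply _ M.measurable_jump, Kernel.prod_apply, Kernel.id_apply,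
    Kernel.comap_apply, Measure.dirac_prod, Measure.map_map M.measurable_jump h]
  rfl

theorem continuous_jump : Continuous M.jump := by
  have hflow : Continuous fun p : (ZigZagSpace × ℝ) × ℝ => M.flow p.1.1 p.2 :=
    M.continuous_flow.comp (by fun_prop : Continuous fun p : (ZigZagSpace × ℝ) × ℝ => (p.1.1, p.2))
  exact ((continuous_fst.comp hflow).prodMk (by fun_prop)).prodMk (by fun_prop)

theorem continuous_flow_until (t : ℝ) :
    Continuous fun p : ZigZagSpace × ℝ => M.flow p.1 (t - p.2) :=
  M.continuous_flow.comp (f := fun p : ZigZagSpace × ℝ => (p.1, t - p.2)) (by fun_prop)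

theorem dist_flow_fst (x : ZigZagSpace) (s : ℝ) : dist (M.flow x s).1 x.1 = M.a * |s| := by
  have hdir : |((x.2 : ℤ) : ℝ)| = 1 := by
    rcases Int.units_eq_one_or x.2 with h | h <;> simp [h]
  simp [flow, hdir, abs_of_pos M.a_pos]

/-- The density of the holding-time law `holdingLaw x` on `(0, ∞)`. -/
noncomputable def holdingDensity (x : ZigZagSpace) (t : ℝ) : ℝ :=
  M.rate (M.flow x t) * M.survival x t

theorem continuous_holdingDensity :
    Continuous fun p : ZigZagSpace × ℝ => M.holdingDensity p.1 p.2 :=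
  M.continuous_rate_flow.mul M.continuous_survival

theorem survival_nonneg (x : ZigZagSpace) (t : ℝ) : 0 ≤ M.survival x t :=
  (Real.exp_pos _).le

theorem survival_le_one (x : ZigZagSpace) {t : ℝ} (ht : 0 ≤ t) : M.survival x t ≤ 1 := by
  rw [survival, Real.exp_le_one_iff, neg_nonpos]
  exact intervalIntegral.integral_nonneg ht fun s _ => M.rate_nonneg _

theorem holdingDensity_nonneg (x : ZigZagSpace) (t : ℝ) : 0 ≤ M.holdingDensity x t :=
  mul_nonneg (M.rate_nonneg _) (M.survival_nonneg x t)

theorem holdingDensity_le_rate (x : ZigZagSpace) {t : ℝ} (ht : 0 ≤ t) :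
    M.holdingDensity x t ≤ M.rate (M.flow x t) :=
  mul_le_of_le_one_right (M.rate_nonneg _) (M.survival_le_one x ht)

theorem ae_holdingLaw_pos (x : ZigZagSpace) : ∀ᵐ z ∂M.holdingLaw x, 0 < z :=
  (withDensity_absolutelyContinuous _ _).ae_le (ae_restrict_mem measurableSet_Ioi)

theorem holdingLaw_real_Ioi (x : ZigZagSpace) (t : ℝ) :
    (M.holdingLaw x).real (Ioi t) = M.survival x (max 0 t) := by
  have hset : (Ioi t : Set ℝ) =ᵐ[M.holdingLaw x] Ioi (max 0 t) := by
    refine eventuallyEq_set.2 ?_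
    filter_upwards [M.ae_holdingLaw_pos x] with z hz
    simp [hz]
  rw [measureReal_congr hset, measureReal_def, M.holdingLaw_Ioi x (le_max_left 0 t),
    ENNReal.toReal_ofReal (M.survival_nonneg x _)]

theorem setIntegral_Iic_holdingLaw {F : Type*} [NormedAddCommGroup F] [NormedSpace ℝ F]
    (x : ZigZagSpace) (g : ℝ → F) (t : ℝ) :
    ∫ z in Iic t, g z ∂M.holdingLaw x =
      ∫ z in (0 : ℝ)..max 0 t, M.holdingDensity x z • g z := by
  have hmeas : Measurable fun z => ENNReal.ofReal (M.holdingDensity x z) :=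
    (M.continuous_holdingDensity.measurable.comp measurable_prodMk_left).ennreal_ofReal
  have hset : Iic t ∩ Ioi 0 = Ioc 0 (max 0 t) := by
    ext z
    simp only [mem_inter_iff, mem_Iic, mem_Ioi, mem_Ioc, le_max_iff]
    grind
  calc ∫ z in Iic t, g z ∂M.holdingLaw x
      = ∫ z in Iic t, (ENNReal.ofReal (M.holdingDensity x z)).toReal • g z
          ∂volume.restrict (Ioi 0) :=
        setIntegral_withDensity_eq_setIntegral_toReal_smul hmeas
          (ae_of_all _ fun _ => ENNReal.ofReal_lt_top) g measurableSet_Iic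
    _ = ∫ z in (0 : ℝ)..max 0 t, M.holdingDensity x z • g z := by
        simp_rw [ENNReal.toReal_ofReal (M.holdingDensity_nonneg x _)]
        rw [Measure.restrict_restrict measurableSet_Iic, hset,
          intervalIntegral.integral_of_le (le_max_left 0 t)]

theorem jumpKernel_real_lt_snd (p : ZigZagSpace × ℝ) (t : ℝ) :
    (M.jumpKernel p).real {q | t < q.2} = M.survival p.1 (max 0 (t - p.2)) := by
  have hpre : (fun z => M.jump (p, z)) ⁻¹' {q | t < q.2} = Ioi (t - p.2) :=
    Set.ext fun z => (sub_lt_iff_lt_add' (a := t) (b := p.2) (c := z)).symm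
  have hjump : Measurable fun z => M.jump (p, z) := M.measurable_jump.comp measurable_prodMk_left
  rw [jumpKernel_apply, map_measureReal_apply hjump
    (measurableSet_lt measurable_const measurable_snd), hpre, holdingLaw_real_Ioi]

theorem setIntegral_jumpKernel_snd_le {F : Type*} [NormedAddCommGroup F] [NormedSpace ℝ F]
    {u : ZigZagSpace × ℝ → F} (hu : StronglyMeasurable u) (p : ZigZagSpace × ℝ) (t : ℝ) :
    ∫ q in {q | q.2 ≤ t}, u q ∂M.jumpKernel p =
      ∫ z in (0 : ℝ)..max 0 (t - p.2), M.holdingDensity p.1 z • u (M.jump (p, z)) := by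
  have hjump : Measurable fun z => M.jump (p, z) := M.measurable_jump.comp measurable_prodMk_left
  have hpre : (fun z => M.jump (p, z)) ⁻¹' {q | q.2 ≤ t} = Iic (t - p.2) :=
    Set.ext fun z => (le_sub_iff_add_le' (a := p.2) (b := z) (c := t)).symm
  rw [jumpKernel_apply, setIntegral_map (measurableSet_le measurable_snd measurable_const)
    hu.aestronglyMeasurable hjump.aemeasurable, hpre, setIntegral_Iic_holdingLaw]

/-- The renewal operator with horizon `t`: the expectation of `u` at the next switch, on the event
that this switch happens no later than time `t`. -/
noncomputable def renewal (t : ℝ) (u : ZigZagSpace × ℝ →ᵇ ℝ) : ZigZagSpace × ℝ →ᵇ ℝ :=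
  .ofNormedAddCommGroup (fun p => ∫ q in {q | q.2 ≤ t}, u q ∂M.jumpKernel p)
    (by
      have hdens : Continuous fun p : (ZigZagSpace × ℝ) × ℝ => M.holdingDensity p.1.1 p.2 :=
        M.continuous_holdingDensity.comp (f := fun p : (ZigZagSpace × ℝ) × ℝ => (p.1.1, p.2))
          (by fun_prop)
      simp_rw [M.setIntegral_jumpKernel_snd_le u.continuous.stronglyMeasurable]
      exact intervalIntegral.continuous_parametric_intervalIntegral_of_continuous
        (f := fun p z => M.holdingDensity p.1 z • u (M.jump (p, z)))
        (hdens.smul (u.continuous.comp M.continuous_jump)) (by fun_prop))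
    ‖u‖
    (fun p => (norm_setIntegral_le_of_norm_le_const (measure_lt_top _ _) fun q _ =>
      u.norm_coe_le_norm q).trans
        (mul_le_of_le_one_right (norm_nonneg u) measureReal_le_one))

theorem renewal_apply (t : ℝ) (u : ZigZagSpace × ℝ →ᵇ ℝ) (p : ZigZagSpace × ℝ) :
    M.renewal t u p = ∫ q in {q | q.2 ≤ t}, u q ∂M.jumpKernel p :=
  rfl

theorem renewal_apply_eq_intervalIntegral (t : ℝ) (u : ZigZagSpace × ℝ →ᵇ ℝ)
    (p : ZigZagSpace × ℝ) :
    M.renewal t u p =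
      ∫ z in (0 : ℝ)..max 0 (t - p.2), M.holdingDensity p.1 z * u (M.jump (p, z)) :=
  M.setIntegral_jumpKernel_snd_le u.continuous.stronglyMeasurable p t

theorem renewal_apply_of_lt {t : ℝ} (u : ZigZagSpace × ℝ →ᵇ ℝ) {p : ZigZagSpace × ℝ}
    (hp : t < p.2) : M.renewal t u p = 0 := by
  rw [renewal_apply_eq_intervalIntegral, max_eq_left (sub_neg.2 hp).le,
    intervalIntegral.integral_same]

/-- The expectation of `φ (Y(t), J(t))` on the event that no switch happens up to time `t`, for the
process that leaves the state `p.1` at time `p.2`. -/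
noncomputable def noSwitchMean (t : ℝ) (φ : ZigZagSpace →ᵇ ℝ) : ZigZagSpace × ℝ →ᵇ ℝ :=
  .ofNormedAddCommGroup
    (fun p => (M.jumpKernel p).real {q | t < q.2} * φ (M.flow p.1 (t - p.2)))
    (by
      have hsurv : Continuous fun p : ZigZagSpace × ℝ => M.survival p.1 (max 0 (t - p.2)) :=
        M.continuous_survival.comp (f := fun p : ZigZagSpace × ℝ => (p.1, max 0 (t - p.2)))
          (by fun_prop)
      simp_rw [jumpKernel_real_lt_snd]
      exact hsurv.mul (φ.continuous.comp (M.continuous_flow_until t)))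
    ‖φ‖
    (fun p => by
      rw [norm_mul, Real.norm_of_nonneg measureReal_nonneg]
      exact (mul_le_of_le_one_left (norm_nonneg _) measureReal_le_one).trans
        (φ.norm_coe_le_norm _))

theorem setIntegral_law_switchTime_le (x : ZigZagSpace) {t : ℝ} (ht : 0 ≤ t)
    (u : ZigZagSpace × ℝ →ᵇ ℝ) (n : ℕ) :
    ∫ ω in {ω | switchTime ω n ≤ t}, u (ω n) ∂M.law x = ((M.renewal t)^[n] u) (x, 0) := by
  induction n generalizing u with
  | zero =>
    have hset : {ω | switchTime ω 0 ≤ t} =ᵐ[M.law x] univ := by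
      refine eventuallyEq_univ.2 ?_
      filter_upwards [M.ae_law_zero x] with ω hω
      simpa [switchTime, hω] using ht
    have hval : (fun ω => u (ω 0)) =ᵐ[M.law x] fun _ => u (x, 0) :=
      (M.ae_law_zero x).mono fun ω hω => congrArg u hω
    rw [setIntegral_congr_set hset, setIntegral_univ, integral_congr_ae hval]
    simp
  | succ n ih =>
    have hstep : ∫ ω in {ω | switchTime ω (n + 1) ≤ t}, u (ω (n + 1)) ∂M.law x =
        ∫ ω, M.renewal t u (ω n) ∂M.law x := by
      have hint : Integrable (fun ω => u (ω (n + 1))) (M.law x) :=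
        .of_bound (u.continuous.measurable.comp (measurable_pi_apply _)).aestronglyMeasurable ‖u‖
          (ae_of_all _ fun ω => u.norm_coe_le_norm _)
      simpa [renewal_apply, switchTime, law_eq_chainLaw] using
        chainLaw.setIntegral_step M.jumpKernel (Measure.dirac (x, 0)) n (B := {q | q.2 ≤ t})
          (f := fun p => u p.2) .univ (measurableSet_le measurable_snd measurable_const)
          u.continuous.stronglyMeasurable.comp_snd hint.integrableOn
    have hlate : ∀ ω ∉ {ω | switchTime ω n ≤ t}, M.renewal t u (ω n) = 0 := fun ω hω =>
      M.renewal_apply_of_lt u (not_le.1 hω)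
    rw [hstep, ← setIntegral_eq_integral_of_forall_compl_eq_zero hlate, ih,
      Function.iterate_succ_apply]

theorem abs_iterate_renewal_le {t Λ : ℝ} (u : ZigZagSpace × ℝ →ᵇ ℝ) (n : ℕ)
    {p : ZigZagSpace × ℝ} (hp : p.2 ≤ t)
    (hΛ : ∀ y : ZigZagSpace, dist y.1 p.1.1 ≤ M.a * (t - p.2) → M.rate y ≤ Λ) :
    |((M.renewal t)^[n] u) p| ≤ ‖u‖ * ((Λ * (t - p.2)) ^ n / n.factorial) := by
  induction n generalizing p with
  | zero => simpa using u.norm_coe_le_norm p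
  | succ n ih =>
    have hτ : 0 ≤ t - p.2 := sub_nonneg.2 hp
    have hbound : ∀ z ∈ Ioc 0 (t - p.2),
        ‖M.holdingDensity p.1 z * ((M.renewal t)^[n] u) (M.jump (p, z))‖ ≤
          ‖u‖ * (Λ * ((Λ * (t - p.2 - z)) ^ n / n.factorial)) := by
      rintro z ⟨hz, hzτ⟩
      have hflow : dist (M.flow p.1 z).1 p.1.1 = M.a * z := by rw [dist_flow_fst, abs_of_pos hz]
      have hdens : M.holdingDensity p.1 z ≤ Λ :=
        (M.holdingDensity_le_rate p.1 hz.le).trans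
          (hΛ _ (hflow.trans_le (mul_le_mul_of_nonneg_left hzτ M.a_pos.le)))
      have hjump : t - (M.jump (p, z)).2 = t - p.2 - z := sub_add_eq_sub_sub t p.2 z
      have hnext := ih (p := M.jump (p, z)) (by linarith) fun y hy => hΛ y <| by
        rw [hjump] at hy
        change dist y.1 (M.flow p.1 z).1 ≤ _ at hy
        linarith [dist_triangle y.1 (M.flow p.1 z).1 p.1.1]
      rw [hjump] at hnext
      rw [norm_mul, Real.norm_of_nonneg (M.holdingDensity_nonneg p.1 z), mul_left_comm]
      exact mul_le_mul hdens hnext (norm_nonneg _) ((M.holdingDensity_nonneg p.1 z).trans hdens)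
    rw [Function.iterate_succ_apply', renewal_apply_eq_intervalIntegral, max_eq_right hτ,
      ← integral_mul_pow_sub_div_factorial, ← intervalIntegral.integral_const_mul]
    exact intervalIntegral.norm_integral_le_of_norm_le hτ (ae_of_all _ hbound)
      (Continuous.intervalIntegrable (by fun_prop) _ _)

theorem exists_rate_le_of_dist_le (R τ : ℝ) :
    ∃ Λ : ℝ, ∀ x : ZigZagSpace, |x.1| ≤ R → ∀ y : ZigZagSpace, dist y.1 x.1 ≤ τ →
      M.rate y ≤ Λ := by
  have hK : IsCompact (Metric.closedBall (0 : ℝ) (τ + R) ×ˢ (univ : Set ℤˣ)) :=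
    (isCompact_closedBall 0 (τ + R)).prod isCompact_univ
  obtain ⟨Λ, hΛ⟩ := hK.bddAbove_image M.rate_continuous.continuousOn
  refine ⟨Λ, fun x hx y hy => hΛ (mem_image_of_mem _ ⟨?_, mem_univ _⟩)⟩
  rw [← Real.dist_0_eq_abs] at hx
  exact (dist_triangle _ _ _).trans (add_le_add hy hx)

theorem measureReal_switchTime_le_le {x : ZigZagSpace} {t Λ : ℝ} (ht : 0 ≤ t)
    (hΛ : ∀ y : ZigZagSpace, dist y.1 x.1 ≤ M.a * t → M.rate y ≤ Λ) (n : ℕ) :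
    (M.law x).real {ω | switchTime ω n ≤ t} ≤ (Λ * t) ^ n / n.factorial := by
  have hone := M.setIntegral_law_switchTime_le x ht (.const _ 1) n
  have hle := (le_abs_self _).trans <|
    M.abs_iterate_renewal_le (.const _ 1) n (p := (x, 0)) ht (by simpa using hΛ)
  rw [← hone] at hle
  simpa using hle

theorem ae_tendsto_switchTime (x : ZigZagSpace) :
    ∀ᵐ ω ∂M.law x, Tendsto (fun n => switchTime ω n) atTop atTop := by
  refine ae_tendsto_atTop_of_tsum_measure_le_ne_top tendsto_natCast_atTop_atTop fun k => ?_
  obtain ⟨Λ, hΛ⟩ := M.exists_rate_le_of_dist_le |x.1| (M.a * k)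
  have hsum : Summable fun n => (M.law x).real {ω | switchTime ω n ≤ k} :=
    .of_nonneg_of_le (fun _ => measureReal_nonneg)
      (M.measureReal_switchTime_le_le k.cast_nonneg (hΛ x le_rfl))
      (Real.summable_pow_div_factorial _)
  simpa [ofReal_measureReal] using hsum.tsum_ofReal_ne_top

theorem ae_dist_step_le (x : ZigZagSpace) :
    ∀ᵐ ω ∂M.law x, ∀ n,
      dist (ω n).1.1 (ω (n + 1)).1.1 ≤ M.a * (switchTime ω (n + 1) - switchTime ω n) := by
  refine chainLaw.ae_forall_step M.jumpKernel _
    (r := fun p => dist p.1.1.1 p.2.1.1 ≤ M.a * (p.2.2 - p.1.2)) ?_ fun p => ?_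
  · exact measurableSet_le (by fun_prop) (by fun_prop)
  · rw [jumpKernel_apply]
    refine (ae_map_iff (M.measurable_jump.comp measurable_prodMk_left).aemeasurable
      (measurableSet_le (by fun_prop) (by fun_prop))).2 ?_
    filter_upwards [M.ae_holdingLaw_pos p.1] with z hz
    change dist p.1.1 (M.flow p.1 z).1 ≤ M.a * (p.2 + z - p.2)
    rw [dist_comm, dist_flow_fst, abs_of_pos hz, add_sub_cancel_left]

theorem ae_monotone_switchTime (x : ZigZagSpace) : ∀ᵐ ω ∂M.law x, Monotone (switchTime ω) := by
  filter_upwards [M.ae_dist_step_le x] with ω hω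
  exact monotone_nat_of_le_succ fun n =>
    sub_nonneg.1 (nonneg_of_mul_nonneg_right (dist_nonneg.trans (hω n)) M.a_pos)

theorem ae_dist_fst_le (x : ZigZagSpace) :
    ∀ᵐ ω ∂M.law x, ∀ n, dist x.1 (ω n).1.1 ≤ M.a * switchTime ω n := by
  filter_upwards [M.ae_law_zero x, M.ae_dist_step_le x] with ω h0 hstep n
  calc dist x.1 (ω n).1.1 = dist (ω 0).1.1 (ω n).1.1 := by rw [h0]
    _ ≤ ∑ i ∈ Finset.range n, M.a * (switchTime ω (i + 1) - switchTime ω i) :=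
        dist_le_range_sum_of_dist_le (f := fun i => (ω i).1.1) n fun {i} _ => hstep i
    _ = M.a * switchTime ω n := by
        rw [← Finset.mul_sum, Finset.sum_range_sub]
        simp [switchTime, h0]

theorem ae_switchCount_eq_iff (x : ZigZagSpace) {t : ℝ} (ht : 0 ≤ t) :
    ∀ᵐ ω ∂M.law x, ∀ n,
      switchCount t ω = n ↔ switchTime ω n ≤ t ∧ t < switchTime ω (n + 1) := by
  filter_upwards [M.ae_law_zero x, M.ae_monotone_switchTime x, M.ae_tendsto_switchTime x]
    with ω h0 hmono hlim n
  exact sSup_setOf_le_eq_iff hmono (by simpa [switchTime, h0] using ht)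
    (hlim.eventually_gt_atTop t).exists

theorem setOf_switchCount_eq_ae_eq (x : ZigZagSpace) {t : ℝ} (ht : 0 ≤ t) (n : ℕ) :
    {ω | switchCount t ω = n} =ᵐ[M.law x]
      {ω | switchTime ω n ≤ t ∧ t < switchTime ω (n + 1)} :=
  eventuallyEq_set.2 <| (M.ae_switchCount_eq_iff x ht).mono fun _ hω => hω n

theorem nullMeasurableSet_switchCount_eq (x : ZigZagSpace) {t : ℝ} (ht : 0 ≤ t) (n : ℕ) :
    NullMeasurableSet {ω | switchCount t ω = n} (M.law x) :=
  ((measurableSet_switchTime_le t n).inter (measurableSet_lt measurable_const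
    (measurable_snd.comp (measurable_pi_apply (n + 1))))).nullMeasurableSet.congr
      (M.setOf_switchCount_eq_ae_eq x ht n).symm

theorem ae_dist_process_le (x : ZigZagSpace) {t : ℝ} (ht : 0 ≤ t) :
    ∀ᵐ ω ∂M.law x, dist x.1 (M.process t ω).1 ≤ M.a * t := by
  filter_upwards [M.ae_dist_fst_le x, M.ae_switchCount_eq_iff x ht] with ω hdist hcount
  have hle : switchTime ω (switchCount t ω) ≤ t := ((hcount _).1 rfl).1
  have hflow := M.dist_flow_fst (ω (switchCount t ω)).1 (t - switchTime ω (switchCount t ω))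
  rw [abs_of_nonneg (sub_nonneg.2 hle), dist_comm] at hflow
  calc dist x.1 (M.process t ω).1
      ≤ dist x.1 (ω (switchCount t ω)).1.1 +
          dist (ω (switchCount t ω)).1.1 (M.process t ω).1 := dist_triangle _ _ _
    _ ≤ M.a * switchTime ω (switchCount t ω) + M.a * (t - switchTime ω (switchCount t ω)) :=
        add_le_add (hdist _) hflow.le
    _ = M.a * t := by ring

theorem aemeasurable_process (x : ZigZagSpace) {t : ℝ} (ht : 0 ≤ t) :
    AEMeasurable (M.process t) (M.law x) := by
  have hcount : AEMeasurable (switchCount t) (M.law x) :=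
    NullMeasurable.aemeasurable <| measurable_to_countable' fun n =>
      M.nullMeasurableSet_switchCount_eq x ht n
  have hflow : Measurable fun p : ℕ × (ℕ → ZigZagSpace × ℝ) =>
      M.flow (p.2 p.1).1 (t - switchTime p.2 p.1) :=
    measurable_from_prod_countable_right fun n =>
      (M.continuous_flow_until t).measurable.comp (measurable_pi_apply n)
  exact hflow.comp_aemeasurable (hcount.prodMk aemeasurable_id)

theorem integrable_process (x : ZigZagSpace) {t : ℝ} (ht : 0 ≤ t) (φ : ZigZagSpace →ᵇ ℝ) :
    Integrable (fun ω => φ (M.process t ω)) (M.law x) :=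
  .of_bound (φ.continuous.measurable.comp_aemeasurable
    (M.aemeasurable_process x ht)).aestronglyMeasurable ‖φ‖
    (ae_of_all _ fun _ => φ.norm_coe_le_norm _)

theorem setIntegral_process_switchCount_eq (x : ZigZagSpace) {t : ℝ} (ht : 0 ≤ t)
    (φ : ZigZagSpace →ᵇ ℝ) (n : ℕ) :
    ∫ ω in {ω | switchCount t ω = n}, φ (M.process t ω) ∂M.law x =
      ((M.renewal t)^[n] (M.noSwitchMean t φ)) (x, 0) := by
  have hcont : Continuous fun p : ZigZagSpace × ℝ => φ (M.flow p.1 (t - p.2)) :=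
    φ.continuous.comp (M.continuous_flow_until t)
  have hint : Integrable (fun ω => φ (M.flow (ω n).1 (t - (ω n).2))) (M.law x) :=
    .of_bound (hcont.measurable.comp (measurable_pi_apply n)).aestronglyMeasurable ‖φ‖
      (ae_of_all _ fun _ => φ.norm_coe_le_norm _)
  calc ∫ ω in {ω | switchCount t ω = n}, φ (M.process t ω) ∂M.law x
      = ∫ ω in {ω | switchCount t ω = n}, φ (M.flow (ω n).1 (t - (ω n).2)) ∂M.law x := by
        refine integral_congr_ae ((ae_restrict_mem₀
          (M.nullMeasurableSet_switchCount_eq x ht n)).mono ?_)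
        rintro ω rfl
        rfl
    _ = ∫ ω in {ω | switchTime ω n ≤ t ∧ t < switchTime ω (n + 1)},
          φ (M.flow (ω n).1 (t - (ω n).2)) ∂M.law x :=
        setIntegral_congr_set (M.setOf_switchCount_eq_ae_eq x ht n)
    _ = ∫ ω in {ω | switchTime ω n ≤ t},
          ∫ _ in {q | t < q.2}, φ (M.flow (ω n).1 (t - (ω n).2)) ∂M.jumpKernel (ω n) ∂M.law x :=
        chainLaw.setIntegral_step M.jumpKernel (Measure.dirac (x, 0)) n
          (A := {p | p.2 ≤ t}) (B := {q | t < q.2}) (f := fun p => φ (M.flow p.1.1 (t - p.1.2)))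
          (measurableSet_le measurable_snd measurable_const)
          (measurableSet_lt measurable_const measurable_snd)
          hcont.stronglyMeasurable.comp_fst hint.integrableOn
    _ = ∫ ω in {ω | switchTime ω n ≤ t}, M.noSwitchMean t φ (ω n) ∂M.law x := by
        simp_rw [setIntegral_const]
        rfl
    _ = ((M.renewal t)^[n] (M.noSwitchMean t φ)) (x, 0) :=
        M.setIntegral_law_switchTime_le x ht _ n

theorem hasSum_semigroup (x : ZigZagSpace) {t : ℝ} (ht : 0 ≤ t) (φ : ZigZagSpace →ᵇ ℝ) :
    HasSum (fun n => ((M.renewal t)^[n] (M.noSwitchMean t φ)) (x, 0)) (M.semigroup t φ x) := by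
  have hdisj : Pairwise
      (Function.onFun (AEDisjoint (M.law x)) fun n => {ω | switchCount t ω = n}) := fun m n hmn =>
    (Set.disjoint_left.2 fun ω hm hn => hmn (hm.symm.trans hn)).aedisjoint
  have hcover : ⋃ n, {ω | switchCount t ω = n} = univ :=
    eq_univ_of_forall fun ω => mem_iUnion.2 ⟨_, rfl⟩
  have hsum := hasSum_integral_iUnion_ae (M.nullMeasurableSet_switchCount_eq x ht)
    hdisj (M.integrable_process x ht φ).integrableOn
  simp_rw [hcover, setIntegral_univ, M.setIntegral_process_switchCount_eq x ht φ] at hsum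
  exact hsum

theorem continuous_semigroup {t : ℝ} (ht : 0 ≤ t) (φ : ZigZagSpace →ᵇ ℝ) :
    Continuous (M.semigroup t φ) := by
  refine continuous_iff_continuousAt.2 fun x₀ => ?_
  let U : Set ZigZagSpace := {x | |x.1| < |x₀.1| + 1}
  have hU : U ∈ 𝓝 x₀ := (isOpen_lt (by fun_prop) continuous_const).mem_nhds (lt_add_one |x₀.1|)
  obtain ⟨Λ, hΛ⟩ := M.exists_rate_le_of_dist_le (|x₀.1| + 1) (M.a * t)
  have hseries : M.semigroup t φ =
      fun x => ∑' n, ((M.renewal t)^[n] (M.noSwitchMean t φ)) (x, 0) :=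
    funext fun x => (M.hasSum_semigroup x ht φ).tsum_eq.symm
  have hcontOn : ContinuousOn (M.semigroup t φ) U := by
    rw [hseries]
    refine continuousOn_tsum (fun n => ?_)
      ((Real.summable_pow_div_factorial (Λ * t)).mul_left ‖M.noSwitchMean t φ‖) fun n x hx => ?_
    · exact (((M.renewal t)^[n] (M.noSwitchMean t φ)).continuous.comp (by fun_prop)).continuousOn
    · have hrate := hΛ x (le_of_lt hx)
      simpa using M.abs_iterate_renewal_le (M.noSwitchMean t φ) n (p := (x, 0)) ht
        (by simpa using hrate)
  exact hcontOn.continuousAt hU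

theorem tendsto_semigroup_cocompact {t : ℝ} (ht : 0 ≤ t) {φ : ZigZagSpace → ℝ}
    (hφ : Tendsto φ (cocompact ZigZagSpace) (𝓝 0)) :
    Tendsto (M.semigroup t φ) (cocompact ZigZagSpace) (𝓝 0) := by
  rw [cocompact_prod_eq_comap_fst, ← Metric.cobounded_eq_cocompact] at hφ ⊢
  exact tendsto_integral_comap_cobounded (fun x => M.ae_dist_process_le x ht) hφ

/-- The image `P(t) φ` of `φ ∈ C₀(E)` under the transition semigroup, as an element of `C₀(E)`. -/
noncomputable def zeroAtInftySemigroup {t : ℝ} (ht : 0 ≤ t) (φ : C₀(ZigZagSpace, ℝ)) :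
    C₀(ZigZagSpace, ℝ) where
  toFun := M.semigroup t φ
  continuous_toFun := M.continuous_semigroup ht φ.toBCF
  zero_at_infty' := M.tendsto_semigroup_cocompact ht φ.zero_at_infty'

end ZigZagModel

theorem mainTheorem7 (M : ZigZagModel) :
    (∀ x : ZigZagSpace, ∀ᵐ ω ∂(M.law x),
      Tendsto (fun n => ZigZagModel.switchTime ω n) atTop atTop) ∧
    ∀ (φ : C₀(ZigZagSpace, ℝ)) (t : ℝ), 0 ≤ t →
      (∀ x : ZigZagSpace, Integrable (fun ω => φ (M.process t ω)) (M.law x)) ∧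
      ∃ ψ : C₀(ZigZagSpace, ℝ), ∀ x : ZigZagSpace, ψ x = M.semigroup t φ x := by
  exact ⟨M.ae_tendsto_switchTime, fun φ t ht =>
    ⟨fun x => M.integrable_process x ht φ.toBCF, M.zeroAtInftySemigroup ht φ, fun _ => rfl⟩⟩
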